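/- Let $M$ be a map in the hyperbolic plane $\mathbb{H}^2$: a simple graph $\Gamma$ whose vertex set $V(M)$ is a set of points of $\mathbb{H}^2$ and whose edges are drawn as simple curves in $\mathbb{H}^2$ joining their endpoints, such that each curve meets $V(M)$ only in its two endpoints, distinct curves meet only in common endpoints, and every connected component of the complement of the drawing is homeomorphic to an open disc. Suppose that $\Gamma$ is connected, locally finite (every vertex has finite degree) and has exactly one end, and that every compact subset of $\mathbb{H}^2$ contains only finitely many points of $V(M)$. Let $G \le \mathrm{Isom}(\mathbb{H}^2)$ act quasi-transitively on $M$, that is, every $g \in G$ maps $V(M)$ onto itself and induces a graph automorphism of $\Gamma$, and $V(M)$ consists of finitely many $G$-orbits. Then every fundamental domain $F$ of $G$ has finite hyperbolic area, $\mu(F) < \infty$; here a fundamental domain of $G$ is an open connected set $F \subset \mathbb{H}^2$ with $\bigcup_{g\in G} g\overline{F} = \mathbb{H}^2$ and $F \cap gF = \emptyset$ for all $g \in G\setminus\{1\}$. -/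

import Mathlib

/-- A map in a surface `X`: a simple graph drawn in `X` without crossings. The vertices are points
of `X`, each edge is a simple curve joining its two endpoints, a curve meets the vertex set only in
its endpoints, different curves meet only in vertices (hence only in common endpoints), and every
face is homeomorphic to the open disc. -/
structure SurfaceMap (X : Type*) [TopologicalSpace X] where
  /-- the vertices -/
  verts : Set X
  /-- the underlying graph -/
  graph : SimpleGraph verts
  /-- the curve drawn for an edge -/
  curve : graph.edgeSet → C(unitInterval, X)
  curve_ends : ∀ e, s(curve e 0, curve e 1) = Sym2.map Subtype.val (e : Sym2 verts)
  curve_injective : ∀ e, Function.Injective (curve e)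
  curve_vertex : ∀ e t (v : verts), curve e t = v → v ∈ (e : Sym2 verts)
  curve_disjoint : ∀ e e', e ≠ e' → ∀ s t, curve e s = curve e' t → curve e s ∈ verts
  face_disc : ∀ x ∈ (verts ∪ ⋃ e, Set.range (curve e))ᶜ,
    Nonempty (connectedComponentIn (verts ∪ ⋃ e, Set.range (curve e))ᶜ x ≃ₜ
      Metric.ball (0 : ℂ) 1)

namespace SurfaceMap

variable {X : Type*}

/-- Every vertex has finite degree. -/
def IsLocallyFinite [TopologicalSpace X] (M : SurfaceMap X) : Prop :=
  ∀ v, (M.graph.neighborSet v).Finite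

/-- The graph has exactly one end. -/
def IsOneEnded [TopologicalSpace X] (M : SurfaceMap X) : Prop :=
  Nonempty (Unique M.graph.end)

/-- The vertices form a locally finite collection: a compact set contains only finitely many. -/
def HasLocallyFiniteVerts [TopologicalSpace X] (M : SurfaceMap X) : Prop :=
  ∀ K : Set X, IsCompact K → (K ∩ M.verts).Finite

/-- A homeomorphism of the surface is a map automorphism if it maps the vertex set onto itself and
induces a graph automorphism there. -/
def IsAutomorphism [TopologicalSpace X] (M : SurfaceMap X) (f : X ≃ₜ X) : Prop :=
  f '' M.verts = M.verts ∧ ∃ φ : M.graph ≃g M.graph, ∀ v, (φ v : X) = f v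

/-- A group of isometries acts quasi-transitively on a map: it acts by map automorphisms, and the
vertex set splits into finitely many orbits. -/
def IsQuasiTransitive [MetricSpace X] (M : SurfaceMap X) (G : Subgroup (X ≃ᵢ X)) : Prop :=
  (∀ g ∈ G, M.IsAutomorphism g.toHomeomorph) ∧
    {O : Set X | ∃ v ∈ M.verts, O = {x | ∃ g ∈ G, g v = x}}.Finite

end SurfaceMap

/-- A fundamental domain of a group of isometries: an open connected set whose translates are
pairwise disjoint and the closures of whose translates cover the space. -/
structure IsFundDomain {X : Type*} [MetricSpace X] (G : Subgroup (X ≃ᵢ X)) (F : Set X) : Prop where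
  isOpen : IsOpen F
  isConnected : IsConnected F
  cover : ⋃ g ∈ G, g '' closure F = Set.univ
  disjoint : ∀ g ∈ G, g ≠ 1 → F ∩ g '' F = ∅

/-! It suffices that the vertex set `V` is coarsely dense: `G` then acts cocompactly, and cutting a
fundamental domain along translates of a compact set bounds its area (`IsFundDomain.volume_lt_top`).
The map enters only through `IsOneEndedOrbitSet`: quasi-transitivity and local finiteness bound the
edge lengths by some `L`, so one-endedness becomes a statement about subsets of `V` with finite
`L`-boundary. If `V` is not coarsely dense, there are arbitrarily large empty discs, which
symmetries move until they touch one of finitely many representatives. A subsequence converges to an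
empty horoball (`exists_forall_dist_le`), whose centre may be taken to be infinity
(`false_of_horoball`). Empty horoballs are impossible (`false_of_im_le`). If all symmetries fix
infinity, they preserve heights, and separation along a vertical line gives a contradiction
(`false_of_isAffine`). Otherwise some symmetry has a finite pole, which also carries an empty
horoball. Only finitely many points lie near the geodesic joining the two centres, so one side of it
is almost empty, and inversion at a boundary point there makes `V` Euclidean-bounded. For bounded
`V` (`false_of_bounded`), two limit points would have a pole between them, and the same geodesic
argument applies. A single limit point, moved to infinity, is fixed by every symmetry, the affine
case again. -/

open UpperHalfPlane MatrixGroups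

/-! ### Isometries of the half-plane in coordinates. -/

theorem UpperHalfPlane.dist_eq_iff_coords (z w z' w' : ℍ) : dist z w = dist z' w' ↔
    ((z.re - w.re) ^ 2 + (z.im - w.im) ^ 2) * (z'.im * w'.im) =
      ((z'.re - w'.re) ^ 2 + (z'.im - w'.im) ^ 2) * (z.im * w.im) := by
  have key : ∀ z w : ℍ, Real.cosh (dist z w) =
      1 + ((z.re - w.re) ^ 2 + (z.im - w.im) ^ 2) / (2 * (z.im * w.im)) := by
    intro z w
    rw [cosh_dist, Complex.dist_eq_re_im, Real.sq_sqrt (by positivity)]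
    simp [mul_assoc]
  have h1 := z.im_pos
  have h2 := w.im_pos
  have h3 := z'.im_pos
  have h4 := w'.im_pos
  rw [← Real.cosh_strictMonoOn.injOn.eq_iff (Set.mem_Ici.2 dist_nonneg)
    (Set.mem_Ici.2 dist_nonneg), key, key, add_right_inj,
    div_eq_div_iff (by positivity) (by positivity)]
  constructor <;> intro h <;> linarith

theorem UpperHalfPlane.J_smul_re (z : ℍ) : (J • z).re = -z.re := by
  rw [← coe_re, coe_J_smul]; simp

theorem UpperHalfPlane.J_smul_im (z : ℍ) : (J • z).im = z.im := by
  rw [← coe_im, coe_J_smul]; simp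

/-- An isometry of the hyperbolic plane that fixes `i` and `2i` is the identity or the reflection in
the imaginary axis. -/
theorem UpperHalfPlane.isometry_eq_of_fixes {f : ℍ → ℍ} (hf : Isometry f)
    (h1 : ∀ z : ℍ, z.re = 0 → z.im = 1 → f z = z)
    (h2 : ∀ z : ℍ, z.re = 0 → z.im = 2 → f z = z) :
    (∀ z, f z = z) ∨ ∀ z, f z = J • z := by
  let i1 : ℍ := ⟨⟨0, 1⟩, by norm_num⟩
  let i2 : ℍ := ⟨⟨0, 2⟩, by norm_num⟩
  let q : ℍ := ⟨⟨1, 1⟩, by norm_num⟩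
  have hi1 : f i1 = i1 := h1 _ rfl rfl
  have hi2 : f i2 = i2 := h2 _ rfl rfl
  have r1 : i1.re = 0 := rfl
  have r2 : i2.re = 0 := rfl
  have m1 : i1.im = 1 := rfl
  have m2 : i2.im = 2 := rfl
  have rq : q.re = 1 := rfl
  have mq : q.im = 1 := rfl
  -- The distances to `i` and `2i` determine a point up to reflection in the imaginary axis.
  have key : ∀ z, (f z).im = z.im ∧ (f z).re ^ 2 = z.re ^ 2 := by
    intro z
    have e1 := hf.dist_eq z i1
    have e2 := hf.dist_eq z i2
    rw [hi1, dist_eq_iff_coords, r1, m1] at e1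
    rw [hi2, dist_eq_iff_coords, r2, m2] at e2
    have e3 : (f z).im = z.im := by linarith
    refine ⟨e3, ?_⟩
    rw [e3] at e1
    have : z.im ≠ 0 := z.im_ne_zero
    have e4 := mul_right_cancel₀ (by simpa using this) e1
    linarith
  obtain ⟨kq1, kq2⟩ := key q
  rw [rq, one_pow] at kq2
  -- The distance to `q = 1 + i` fixes the remaining sign, the same for all `z`.
  have re_eq : ∀ z, (f z).re * (f q).re = z.re := by
    intro z
    have e := hf.dist_eq z q
    obtain ⟨k1, k2⟩ := key z
    rw [dist_eq_iff_coords, kq1, k1, rq, mq] at e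
    have e4 := mul_right_cancel₀ (by simpa using z.im_ne_zero) e
    nlinarith
  have hq : (f q).re = 1 ∨ (f q).re = -1 := by
    rcases mul_eq_zero.1 (show ((f q).re - 1) * ((f q).re + 1) = 0 by linarith) with h | h
    · left; linarith
    · right; linarith
  rcases hq with hq | hq
  · left
    intro z
    have := re_eq z
    rw [hq, mul_one] at this
    exact UpperHalfPlane.ext (Complex.ext this (key z).1)
  · right
    intro z
    have := re_eq z
    rw [hq] at this
    refine UpperHalfPlane.ext (Complex.ext ?_ ?_)
    · rw [coe_re, coe_re, J_smul_re]; linarith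
    · rw [coe_im, coe_im, J_smul_im]; exact (key z).1

/-- Some rotation about `i` moves a given point to the imaginary axis. -/
theorem UpperHalfPlane.exists_rotation_re_eq_zero (w : ℍ) :
    ∃ A : SL(2, ℝ), A • I = I ∧ (A • w).re = 0 := by
  -- The numerator of the real part of the rotated `w`; it changes sign over a quarter period.
  let φ : ℝ → ℝ := fun θ => (Real.cos θ ^ 2 - Real.sin θ ^ 2) * w.re +
    Real.cos θ * Real.sin θ * (1 - w.re ^ 2 - w.im ^ 2)
  have hφ : Continuous φ := by fun_prop
  have h0 : φ 0 = w.re := by simp [φ]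
  have h1 : φ (Real.pi / 2) = -w.re := by simp [φ]
  obtain ⟨θ, hθ⟩ : ∃ θ, φ θ = 0 := by
    have := mem_range_of_exists_le_of_exists_ge (c := 0) hφ
      (by rcases le_total w.re 0 with h | h
          · exact ⟨0, by rw [h0]; exact h⟩
          · exact ⟨Real.pi / 2, by rw [h1]; linarith⟩)
      (by rcases le_total w.re 0 with h | h
          · exact ⟨Real.pi / 2, by rw [h1]; linarith⟩
          · exact ⟨0, by rw [h0]; exact h⟩)
    exact this
  let A : SL(2, ℝ) := ⟨!![Real.cos θ, Real.sin θ; -Real.sin θ, Real.cos θ], by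
    rw [Matrix.det_fin_two_of]; nlinarith [Real.sin_sq_add_cos_sq θ]⟩
  have key : ∀ z : ℍ, ((A • z : ℍ) : ℂ) = (Real.cos θ * z + Real.sin θ) / (-Real.sin θ * z + Real.cos θ) := by
    intro z
    rw [coe_specialLinearGroup_apply]
    simp [A]
  have hne : ∀ z : ℍ, (-Real.sin θ * z + Real.cos θ : ℂ) ≠ 0 := by
    intro z
    have := denom_ne_zero (A : GL (Fin 2) ℝ) z
    simpa [denom, A, Matrix.SpecialLinearGroup.toGL] using! this
  refine ⟨A, ?_, ?_⟩
  · refine UpperHalfPlane.ext ?_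
    rw [key, div_eq_iff (hne I)]
    have : (Complex.I) * Complex.I = -1 := Complex.I_mul_I
    simp only [coe_I]
    linear_combination (Real.sin θ : ℂ) * this
  · rw [← coe_re, key, Complex.div_re, ← add_div, div_eq_zero_iff]
    left
    simp only [Complex.add_re, Complex.mul_re, Complex.ofReal_re, Complex.ofReal_im, Complex.add_im,
      Complex.mul_im, Complex.neg_re, Complex.neg_im, coe_re, coe_im]
    simp only [φ] at hθ
    linear_combination hθ

/-- Every isometry of the hyperbolic plane is given by a real invertible matrix. -/
theorem UpperHalfPlane.exists_smul_eq_of_isometry {f : ℍ → ℍ} (hf : Isometry f) :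
    ∃ A : GL (Fin 2) ℝ, ∀ z, f z = A • z := by
  have I_eq : ∀ z : ℍ, z.re = 0 → z.im = 1 → z = I := fun z h1 h2 =>
    UpperHalfPlane.ext (Complex.ext (by simpa using h1) (by simpa using h2))
  let i2 : ℍ := ⟨⟨0, 2⟩, by norm_num⟩
  have i2_eq : ∀ z : ℍ, z.re = 0 → z.im = 2 → z = i2 := fun z h1 h2 =>
    UpperHalfPlane.ext (Complex.ext h1 h2)
  have r2 : i2.re = 0 := rfl
  have m2 : i2.im = 2 := rfl
  obtain ⟨A, hA⟩ := MulAction.exists_smul_eq SL(2, ℝ) (f I) I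
  obtain ⟨B, hB, hB2⟩ := exists_rotation_re_eq_zero (A • f i2)
  have hS : ∀ z : ℍ, z.re = 0 → (ModularGroup.S • z).re = 0 ∧ (ModularGroup.S • z).im * z.im = 1 := by
    intro z hz
    have e : (z : ℂ) = z.im * Complex.I := Complex.ext (by simpa using hz) (by simp)
    have hy : (z.im : ℂ) ≠ 0 := by exact_mod_cast z.im_ne_zero
    have : ((ModularGroup.S • z : ℍ) : ℂ) = (z.im)⁻¹ * Complex.I := by
      rw [modular_S_smul]
      simp [e, mul_comm]
    rw [← coe_re, ← coe_im, this]
    simp [z.im_ne_zero]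
  -- On the imaginary axis only `2i` and `i/2` have the right distance to `i`, and `S` swaps them.
  obtain ⟨C, hC1, hC2⟩ : ∃ C : SL(2, ℝ), C • I = I ∧ C • (B • A • f i2) = i2 := by
    have hd : dist (B • A • f i2) I = dist i2 I := by
      conv_lhs => rw [← hB, dist_smul, ← hA, dist_smul, hf.dist_eq]
    set w := B • A • f i2
    rw [dist_eq_iff_coords, hB2, r2, m2, I_re, I_im] at hd
    have : (w.im - 2) * (w.im - 1 / 2) = 0 := by linarith
    rcases mul_eq_zero.1 this with h | h
    · exact ⟨1, one_smul _ _, by rw [one_smul]; exact i2_eq _ hB2 (by linarith)⟩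
    · refine ⟨(ModularGroup.S : SL(2, ℤ)), ?_, ?_⟩
      · obtain ⟨h1, h2⟩ := hS I I_re
        rw [I_im, mul_one] at h2
        exact I_eq _ h1 h2
      · obtain ⟨h1, h2⟩ := hS w hB2
        exact i2_eq _ h1 (by
          have : w.im = 1 / 2 := by linarith
          rw [this] at h2
          have h3 : (ModularGroup.S • w).im = 2 := by linarith
          exact h3)
  let D : SL(2, ℝ) := C * B * A
  have hD : Isometry fun z => D • f z := (isometry_smul ℍ D).comp hf
  have back : ∀ z, f z = ((D⁻¹ : SL(2, ℝ)) : GL (Fin 2) ℝ) • D • f z := fun z =>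
    (inv_smul_smul D (f z)).symm
  rcases isometry_eq_of_fixes hD
    (fun z h1 h2 => by rw [I_eq z h1 h2]; simp only [D, mul_smul, hA, hB, hC1])
    (fun z h1 h2 => by rw [i2_eq z h1 h2]; simp only [D, mul_smul, hC2]) with h | h
  · exact ⟨_, fun z => (back z).trans (by rw [h z])⟩
  · exact ⟨((D⁻¹ : SL(2, ℝ)) : GL (Fin 2) ℝ) * J, fun z => (back z).trans (by rw [h z, mul_smul])⟩

/-- The action of an isometry in coordinates: either it is affine, or it has a pole `τ` on the real
line and sends infinity to a real point `κ`. -/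
theorem UpperHalfPlane.isometry_coords {f : ℍ → ℍ} (hf : Isometry f) :
    (∃ a b ε : ℝ, 0 < a ∧ (ε = 1 ∨ ε = -1) ∧
      ∀ z, (f z).im = a * z.im ∧ (f z).re = ε * a * z.re + b) ∨
    ∃ k τ κ : ℝ, 0 < k ∧ ∀ z : ℍ, (f z).im * ((z.re - τ) ^ 2 + z.im ^ 2) = k * z.im ∧
      (((f z).re - κ) ^ 2 + (f z).im ^ 2) * ((z.re - τ) ^ 2 + z.im ^ 2) = k ^ 2 := by
  obtain ⟨A, hA⟩ := exists_smul_eq_of_isometry hf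
  obtain ⟨p, hp⟩ : ∃ p, p = A 0 0 := ⟨_, rfl⟩
  obtain ⟨q, hq⟩ : ∃ q, q = A 0 1 := ⟨_, rfl⟩
  obtain ⟨r, hr⟩ : ∃ r, r = A 1 0 := ⟨_, rfl⟩
  obtain ⟨s, hs⟩ : ∃ s, s = A 1 1 := ⟨_, rfl⟩
  obtain ⟨d, hd⟩ : ∃ d, d = A.det.val := ⟨_, rfl⟩
  have hd0 : d ≠ 0 := by rw [hd]; exact A.det.ne_zero
  have hdet : d = p * s - q * r := by
    rw [hd, Matrix.GeneralLinearGroup.val_det_apply, A.1.det_fin_two, hp, hq, hr, hs]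
  have nsq : ∀ z : ℍ, Complex.normSq (denom A z) = (r * z.re + s) ^ 2 + (r * z.im) ^ 2 := by
    intro z
    simp only [denom, Complex.normSq_apply, ← hr, ← hs]
    simp
    ring
  have npos : ∀ z : ℍ, 0 < (r * z.re + s) ^ 2 + (r * z.im) ^ 2 := fun z => by
    rw [← nsq]; exact normSq_denom_pos A z.im_ne_zero
  have him : ∀ z, (f z).im = |d| * z.im / ((r * z.re + s) ^ 2 + (r * z.im) ^ 2) := by
    intro z
    rw [hA, im_smul_eq_div_normSq, nsq, hd]
  have hre : ∀ z, (f z).re = ((p * z.re + q) * (r * z.re + s) + p * z.im * (r * z.im)) /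
      ((r * z.re + s) ^ 2 + (r * z.im) ^ 2) := by
    intro z
    rw [hA, re_smul, Complex.div_re, nsq, ← add_div]
    simp only [num, denom, ← hp, ← hq, ← hr, ← hs]
    simp
  by_cases h : r = 0
  · left
    subst h
    have hs0 : s ≠ 0 := by rintro rfl; simp [hdet] at hd0
    have hp0 : p ≠ 0 := by rintro rfl; simp [hdet] at hd0
    have hd' : |d| = |p / s| * s ^ 2 := by
      rw [hdet, abs_div, ← sq_abs s, mul_zero, sub_zero, abs_mul]
      field_simp
    rcases abs_choice (p / s) with hc | hc
    · refine ⟨|p / s|, q / s, 1, by positivity, Or.inl rfl, fun z => ⟨?_, ?_⟩⟩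
      · rw [him, hd']; field_simp; ring
      · rw [hre, hc]; field_simp; ring
    · refine ⟨|p / s|, q / s, -1, by positivity, Or.inr rfl, fun z => ⟨?_, ?_⟩⟩
      · rw [him, hd']; field_simp; ring
      · rw [hre, hc]; field_simp; ring
  · right
    have hsq : |d| ^ 2 = (p * s - q * r) ^ 2 := by rw [sq_abs, hdet]
    -- The second identity is the squared form of `|f z - κ| * |z - τ| = k`.
    refine ⟨|d| / r ^ 2, -s / r, p / r, by positivity, fun z => ?_⟩
    have hN := (npos z).ne'
    have e : (z.re - -s / r) ^ 2 + z.im ^ 2 = ((r * z.re + s) ^ 2 + (r * z.im) ^ 2) / r ^ 2 := by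
      field_simp; ring
    refine ⟨?_, ?_⟩
    · rw [him, e]; field_simp
    · have hre' : (f z).re - p / r = -(p * s - q * r) * (r * z.re + s) /
          (r * ((r * z.re + s) ^ 2 + (r * z.im) ^ 2)) := by
        rw [hre]; field_simp; ring
      rw [hre', him, e, div_pow, div_pow, mul_pow |d|, div_pow |d|, hsq]
      field_simp

/-- The inversion that moves the real point `c` to infinity. -/
theorem UpperHalfPlane.exists_inversion (c : ℝ) : ∃ φ : ℍ ≃ᵢ ℍ, ∀ z : ℍ,
    (φ z).im * ((z.re - c) ^ 2 + z.im ^ 2) = z.im ∧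
      ((φ z).re ^ 2 + (φ z).im ^ 2) * ((z.re - c) ^ 2 + z.im ^ 2) = 1 := by
  let A : SL(2, ℝ) := ⟨!![0, -1; 1, -c], by rw [Matrix.det_fin_two_of]; ring⟩
  refine ⟨IsometryEquiv.constSMul A, fun z => ?_⟩
  have hz := z.im_pos
  have key : ((A • z : ℍ) : ℂ) = -1 / (z - c) := by
    rw [coe_specialLinearGroup_apply]
    simp [A, sub_eq_add_neg]
  have hn : Complex.normSq ((z : ℂ) - c) = (z.re - c) ^ 2 + z.im ^ 2 := by
    simp [Complex.normSq_apply]; ring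
  have h1 : (A • z).im = z.im / ((z.re - c) ^ 2 + z.im ^ 2) := by
    rw [← coe_im, key, Complex.div_im, hn]; simp [neg_div]
  have h2 : (A • z).re = -(z.re - c) / ((z.re - c) ^ 2 + z.im ^ 2) := by
    rw [← coe_re, key, Complex.div_re, hn]; simp
  simp only [IsometryEquiv.constSMul_apply]
  rw [h1, h2]
  have : (z.re - c) ^ 2 + z.im ^ 2 ≠ 0 := by positivity
  constructor <;> field_simp

/-! ### One-ended graphs. -/

namespace SimpleGraph

/-- In a connected locally finite graph with a single end, at most one component of the complement
of a finite set is infinite. -/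
theorem ComponentCompl.eq_of_infinite_of_unique_end {V : Type} (G : SimpleGraph V)
    (hc : G.Preconnected) (hlf : ∀ v, (G.neighborSet v).Finite) (he : Nonempty (Unique G.end))
    (K : Finset V) (C D : G.ComponentCompl K) (hC : C.supp.Infinite) (hD : D.supp.Infinite) :
    C = D := by
  classical
  have : G.LocallyFinite := fun v => (hlf v).fintype
  have : Fact G.Preconnected := ⟨hc⟩
  obtain ⟨hu⟩ := he
  have : Infinite V := Set.infinite_univ_iff.1 (hC.mono (Set.subset_univ _))
  have hML : G.componentComplFunctor.IsMittagLeffler :=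
    CategoryTheory.Functor.isMittagLeffler_of_exists_finite_range _ fun j =>
      ⟨j, CategoryTheory.CategoryStruct.id j, Set.toFinite _⟩
  have := fun j => G.componentComplFunctor.toEventualRanges_nonempty hML j
  -- By Mittag-Leffler every infinite component is selected by some end, so two such components
  -- would give two ends.
  have hex : ∀ E : G.ComponentCompl K, E.supp.Infinite →
      ∃ s : G.componentComplFunctor.sections, s.val (Opposite.op K) = E := by
    intro E hE
    have h1 := (G.infinite_iff_in_eventualRange (K := Opposite.op K) E).1 hE
    obtain ⟨s, hs⟩ := G.componentComplFunctor.toEventualRanges.eval_section_surjective_of_surjective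
      (G.componentComplFunctor.surjective_toEventualRanges hML) (Opposite.op K) ⟨E, h1⟩
    exact ⟨G.componentComplFunctor.toEventualRangesSectionsEquiv s, congrArg Subtype.val hs⟩
  obtain ⟨s, hs⟩ := hex C hC
  obtain ⟨t, ht⟩ := hex D hD
  have hst : s = t := @Subsingleton.elim _ (@Unique.instSubsingleton _ hu) s t
  rw [← hs, ← ht, hst]

/-- A set of vertices with finite boundary in a connected locally finite graph with a single end is
finite or cofinite. -/
theorem finite_or_finite_compl_of_unique_end {V : Type} (G : SimpleGraph V)
    (hc : G.Preconnected) (hlf : ∀ v, (G.neighborSet v).Finite) (he : Nonempty (Unique G.end))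
    (A : Set V) (hA : {u | u ∈ A ∧ ∃ v ∉ A, G.Adj u v}.Finite) : A.Finite ∨ Aᶜ.Finite := by
  classical
  have : G.LocallyFinite := fun v => (hlf v).fintype
  have : Fact G.Preconnected := ⟨hc⟩
  let K := hA.toFinset
  have hK : ∀ u v, u ∉ K → u ∈ A → G.Adj u v → v ∈ A := by
    intro u v hu huA huv
    by_contra hv
    exact hu (hA.mem_toFinset.2 ⟨huA, v, hv, huv⟩)
  -- Off the boundary `K`, edges do not leave `A`, so each component lies in `A` or in its
  -- complement.
  let P : G.ComponentCompl K → Prop := ComponentCompl.lift (fun v _ => v ∈ A)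
    (fun v w hv hw a => propext ⟨fun h => hK v w hv h a, fun h => hK w v hw h a.symm⟩)
  have hP : ∀ v (hv : v ∉ K), P (G.componentComplMk hv) ↔ v ∈ A := fun v hv => Iff.rfl
  have hfin : ∀ Q : G.ComponentCompl K → Prop, (∀ C, Q C → C.supp.Finite) →
      {v | ∃ hv : v ∉ K, Q (G.componentComplMk hv)}.Finite := by
    intro Q hQ
    have : (⋃ C ∈ {C | Q C}, C.supp).Finite :=
      (Set.toFinite {C | Q C}).biUnion fun C hC => hQ C hC
    refine this.subset ?_
    rintro v ⟨hv, hq⟩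
    exact Set.mem_biUnion hq (G.componentComplMk_mem hv)
  by_cases h1 : ∀ C, P C → C.supp.Finite
  · left
    refine (K.finite_toSet.union (hfin P h1)).subset fun v hv => ?_
    by_cases hvK : v ∈ K
    · exact Or.inl hvK
    · exact Or.inr ⟨hvK, (hP v hvK).2 hv⟩
  · right
    push Not at h1
    obtain ⟨C, hPC, hC⟩ := h1
    have h2 : ∀ D, ¬ P D → D.supp.Finite := by
      intro D hD
      by_contra hD'
      exact hD (ComponentCompl.eq_of_infinite_of_unique_end G hc hlf he K C D hC hD' ▸ hPC)
    refine (K.finite_toSet.union (hfin (fun D => ¬ P D) h2)).subset fun v hv => ?_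
    by_cases hvK : v ∈ K
    · exact Or.inl hvK
    · exact Or.inr ⟨hvK, fun h => hv ((hP v hvK).1 h)⟩

end SimpleGraph

/-! ### Coarsely one-ended orbit sets. -/

/-- An infinite locally finite set of points of the hyperbolic plane that its isometric symmetries
divide into finitely many orbits, and that is coarsely one-ended: for some `L`, a subset that has
only finitely many points within distance `L` of the remaining ones is finite or cofinite. -/
structure IsOneEndedOrbitSet (V : Set ℍ) : Prop where
  infinite : V.Infinite
  finite_inter : ∀ K : Set ℍ, IsCompact K → (K ∩ V).Finite
  orbits : ∃ S ⊆ V, S.Finite ∧ ∀ v ∈ V, ∃ g : ℍ ≃ᵢ ℍ, g '' V = V ∧ ∃ s ∈ S, g s = v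
  separation : ∃ L : ℝ, ∀ A ⊆ V, {u | u ∈ A ∧ ∃ v ∈ V \ A, dist u v ≤ L}.Finite →
    A.Finite ∨ (V \ A).Finite

theorem UpperHalfPlane.isCompact_box {B c : ℝ} (hc : 0 < c) :
    IsCompact {z : ℍ | |z.re| ≤ B ∧ c ≤ z.im ∧ z.im ≤ B} := by
  rw [isOpenEmbedding_coe.isInducing.isCompact_iff]
  have : UpperHalfPlane.coe '' {z : ℍ | |z.re| ≤ B ∧ c ≤ z.im ∧ z.im ≤ B} =
      Set.Icc (-B) B ×ℂ Set.Icc c B := by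
    ext w
    simp only [Set.mem_image, Set.mem_ofPred_eq, Complex.mem_reProdIm, Set.mem_Icc, abs_le]
    constructor
    · rintro ⟨z, h, rfl⟩
      exact h
    · intro h
      exact ⟨⟨w, hc.trans_le h.2.1⟩, h, rfl⟩
  rw [this]
  exact isCompact_Icc.reProdIm isCompact_Icc

theorem IsometryEquiv.symm_image_eq_of_image_eq {X : Type*} [PseudoEMetricSpace X] {g : X ≃ᵢ X}
    {V : Set X} (h : g '' V = V) : g.symm '' V = V := by
  conv_lhs => rw [← h]
  rw [← Set.image_comp]
  simp

namespace IsOneEndedOrbitSet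

variable {V : Set ℍ}

theorem image (hV : IsOneEndedOrbitSet V) (φ : ℍ ≃ᵢ ℍ) : IsOneEndedOrbitSet (φ '' V) where
  infinite := hV.infinite.image φ.injective.injOn
  finite_inter K hK := by
    have h := (hV.finite_inter _ (hK.image φ.symm.continuous)).image φ
    refine h.subset ?_
    rintro _ ⟨hx, v, hv, rfl⟩
    exact ⟨v, ⟨⟨φ v, hx, by simp⟩, hv⟩, rfl⟩
  orbits := by
    obtain ⟨S, hSV, hS, h⟩ := hV.orbits
    refine ⟨φ '' S, Set.image_mono hSV, hS.image _, ?_⟩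
    rintro _ ⟨v, hv, rfl⟩
    obtain ⟨g, hg, s, hs, rfl⟩ := h v hv
    refine ⟨(φ.symm.trans g).trans φ, ?_, φ s, Set.mem_image_of_mem _ hs, by simp⟩
    have : ⇑((φ.symm.trans g).trans φ) = φ ∘ g ∘ φ.symm := rfl
    rw [this, Set.image_comp, Set.image_comp, ← Set.image_comp φ.symm φ]
    simp [hg]
  separation := by
    obtain ⟨L, h⟩ := hV.separation
    refine ⟨L, fun A hA hfin => ?_⟩
    have hsub : φ ⁻¹' A ⊆ V := fun x hx => by
      obtain ⟨v, hv, e⟩ := hA hx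
      rwa [← φ.injective e]
    have hAeq : φ '' (φ ⁻¹' A) = A := Set.image_preimage_eq _ φ.surjective
    have hb : {u | u ∈ φ ⁻¹' A ∧ ∃ v ∈ V \ φ ⁻¹' A, dist u v ≤ L}.Finite := by
      refine Set.Finite.of_finite_image (f := φ) (hfin.subset ?_) φ.injective.injOn
      rintro _ ⟨u, ⟨hu, v, hv, huv⟩, rfl⟩
      exact ⟨hu, φ v, ⟨Set.mem_image_of_mem _ hv.1, hv.2⟩, by rwa [φ.dist_eq]⟩
    rcases h _ hsub hb with h1 | h1
    · left; rw [← hAeq]; exact h1.image _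
    · right
      refine (h1.image φ).subset ?_
      rintro _ ⟨⟨v, hv, rfl⟩, hvA⟩
      exact ⟨v, ⟨hv, hvA⟩, rfl⟩

theorem finite_box (hV : IsOneEndedOrbitSet V) (B : ℝ) {c : ℝ} (hc : 0 < c) :
    {v | v ∈ V ∧ |v.re| ≤ B ∧ c ≤ v.im ∧ v.im ≤ B}.Finite :=
  (hV.finite_inter _ (isCompact_box (B := B) hc)).subset fun _ hv => ⟨hv.2, hv.1⟩

/-! ### Separation along geodesics. -/

/-- If only finitely many points lie near a vertical line, then one of its sides contains only
finitely many points. -/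
theorem finite_side (hV : IsOneEndedOrbitSet V) (t : ℝ)
    (h : ∀ C : ℝ, {v | v ∈ V ∧ |v.re - t| ≤ C * v.im}.Finite) :
    {v | v ∈ V ∧ v.re ≤ t}.Finite ∨ {v | v ∈ V ∧ t ≤ v.re}.Finite := by
  obtain ⟨L, hL⟩ := hV.separation
  -- If an `L`-close pair straddles the line, its left point `u` has `|u.re - t| ≤ (exp L - 1) *
  -- u.im`, so it lies in a cone about the line.
  have hb : {u | u ∈ {v | v ∈ V ∧ v.re ≤ t} ∧
      ∃ v ∈ V \ {v | v ∈ V ∧ v.re ≤ t}, dist u v ≤ L}.Finite := by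
    refine (h (Real.exp L - 1)).subset ?_
    rintro u ⟨⟨hu, hut⟩, v, ⟨hv, hvt⟩, hd⟩
    refine ⟨hu, ?_⟩
    have hvt' : t < v.re := by
      by_contra h'
      exact hvt ⟨hv, not_lt.1 h'⟩
    have h1 : |(v : ℂ).re - (u : ℂ).re| ≤ dist (v : ℂ) u := by
      rw [Complex.dist_eq, ← Complex.sub_re]
      exact Complex.abs_re_le_norm _
    have h2 := dist_coe_le v u
    have h3 : Real.exp (dist v u) ≤ Real.exp L := Real.exp_le_exp.2 (by rwa [dist_comm])
    have h4 : u.im * (Real.exp (dist v u) - 1) ≤ u.im * (Real.exp L - 1) :=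
      mul_le_mul_of_nonneg_left (by linarith) u.im_pos.le
    have h5 : |u.re - t| ≤ |(v : ℂ).re - (u : ℂ).re| := by
      rw [coe_re, coe_re, abs_of_nonpos (by linarith), abs_of_nonneg (by linarith)]
      linarith
    linarith
  rcases hL {v | v ∈ V ∧ v.re ≤ t} (fun v hv => hv.1) hb with h1 | h1
  · exact Or.inl h1
  · right
    refine (h1.union (h 0)).subset ?_
    rintro v ⟨hv, hvt⟩
    rcases eq_or_lt_of_le hvt with e | e
    · exact Or.inr ⟨hv, by simp [e]⟩
    · exact Or.inl ⟨hv, fun h' => absurd h'.2 (not_le.2 e)⟩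

/-- If a horoball at infinity and one at the real point `τ` contain no points, then one of the sides
of the geodesic between their centres contains only finitely many points. -/
theorem finite_side_of_horoballs (hV : IsOneEndedOrbitSet V) {A k τ : ℝ} (hk : 0 < k)
    (hA : ∀ v ∈ V, v.im ≤ A)
    (hτ : ∀ v ∈ V, k * v.im ≤ A * ((v.re - τ) ^ 2 + v.im ^ 2)) :
    {v | v ∈ V ∧ v.re ≤ τ}.Finite ∨ {v | v ∈ V ∧ τ ≤ v.re}.Finite := by
  obtain ⟨v₀, hv₀⟩ := hV.infinite.nonempty
  have hApos : 0 < A := v₀.im_pos.trans_le (hA _ hv₀)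
  refine hV.finite_side τ fun C => ?_
  -- The horoball at infinity truncates the cone from above; the one at `τ` truncates it from below
  -- at this height.
  have hc : 0 < k / (A * (C ^ 2 + 1)) := by positivity
  refine (hV.finite_box (|τ| + (|C| + 1) * A) hc).subset ?_
  rintro v ⟨hv, hvC⟩
  have hy := v.im_pos
  have hyA := hA v hv
  refine ⟨hv, ?_, ?_, ?_⟩
  · have h1 : |v.re| ≤ |v.re - τ| + |τ| := by
      have := abs_add_le (v.re - τ) τ
      simpa using this
    have h2 : C * v.im ≤ |C| * A := by
      calc C * v.im ≤ |C| * v.im := mul_le_mul_of_nonneg_right (le_abs_self C) hy.le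
        _ ≤ |C| * A := mul_le_mul_of_nonneg_left hyA (abs_nonneg C)
    linarith
  · rw [div_le_iff₀ (by positivity)]
    have h1 : (v.re - τ) ^ 2 ≤ (C * v.im) ^ 2 := sq_le_sq.2 (hvC.trans (le_abs_self _))
    have h2 := hτ v hv
    have h3 : A * ((v.re - τ) ^ 2 + v.im ^ 2) ≤ A * ((C * v.im) ^ 2 + v.im ^ 2) :=
      mul_le_mul_of_nonneg_left (by linarith) hApos.le
    refine le_of_mul_le_mul_right ?_ hy
    nlinarith
  · have : 0 ≤ |τ| + |C| * A := by positivity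
    linarith

/-! ### Symmetries fixing infinity. -/

/-- The isometry `g` is a similarity of the half-plane with respect to the Euclidean metric. -/
def IsAffine (g : ℍ ≃ᵢ ℍ) : Prop :=
  ∃ a b ε : ℝ, 0 < a ∧ (ε = 1 ∨ ε = -1) ∧ ∀ z, (g z).im = a * z.im ∧ (g z).re = ε * a * z.re + b

/-- If the symmetries preserve all horocycles at infinity, then the points reach infinitely far to
both sides. -/
theorem false_of_im_eq_of_finite_side (hV : IsOneEndedOrbitSet V)
    (hg : ∀ g : ℍ ≃ᵢ ℍ, g '' V = V → ∃ b ε : ℝ, (ε = 1 ∨ ε = -1) ∧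
      ∀ z, (g z).im = z.im ∧ (g z).re = ε * z.re + b)
    (δ : ℝ) (hδ : δ = 1 ∨ δ = -1) (hside : {v | v ∈ V ∧ δ * v.re ≤ 0}.Finite) : False := by
  obtain ⟨S, hSV, hS, hSg⟩ := hV.orbits
  have hS0 : S.Nonempty := by
    obtain ⟨v, hv⟩ := hV.infinite.nonempty
    obtain ⟨g, -, s, hs, -⟩ := hSg v hv
    exact ⟨s, hs⟩
  obtain ⟨c, hc, hcS⟩ : ∃ c : ℝ, 0 < c ∧ ∀ s ∈ S, c ≤ s.im := by
    obtain ⟨s, hs, h⟩ := Set.exists_min_image S UpperHalfPlane.im hS hS0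
    exact ⟨s.im, s.im_pos, h⟩
  obtain ⟨M, hM⟩ : ∃ M : ℝ, ∀ s ∈ S, s.im ≤ M ∧ δ * s.re ≤ M := by
    obtain ⟨s, -, h⟩ := Set.exists_max_image S UpperHalfPlane.im hS hS0
    obtain ⟨s', -, h'⟩ := Set.exists_max_image S (fun s => δ * s.re) hS hS0
    exact ⟨max s.im (δ * s'.re), fun x hx =>
      ⟨(h x hx).trans (le_max_left _ _), (h' x hx).trans (le_max_right _ _)⟩⟩
  have hVim : ∀ v ∈ V, c ≤ v.im ∧ v.im ≤ M := by
    intro v hv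
    obtain ⟨g, hgV, s, hs, rfl⟩ := hSg v hv
    obtain ⟨b, ε, -, h⟩ := hg g hgV
    rw [(h s).1]
    exact ⟨hcS s hs, (hM s hs).1⟩
  obtain ⟨m, hm⟩ : ∃ m : ℝ, ∀ v ∈ V, m ≤ δ * v.re := by
    rcases Set.eq_empty_or_nonempty {v | v ∈ V ∧ δ * v.re ≤ 0} with h | h
    · refine ⟨0, fun v hv => ?_⟩
      by_contra h'
      exact Set.eq_empty_iff_forall_notMem.1 h v ⟨hv, (not_le.1 h').le⟩
    · obtain ⟨w, hw, h⟩ := Set.exists_min_image _ (fun s : ℍ => δ * s.re) hside h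
      refine ⟨δ * w.re, fun v hv => ?_⟩
      by_cases h' : δ * v.re ≤ 0
      · exact h v ⟨hv, h'⟩
      · exact hw.2.trans (not_le.1 h').le
  have habs : ∀ x : ℝ, |δ * x| = |x| := by
    intro x
    rcases hδ with rfl | rfl <;> simp
  have hub : ∀ R : ℝ, ∃ v ∈ V, R < δ * v.re := by
    intro R
    by_contra hR
    push Not at hR
    refine hV.infinite ((hV.finite_box (max (max |m| |R|) M) hc).subset fun v hv => ⟨hv, ?_, (hVim v hv).1, ?_⟩)
    · rw [← habs]
      refine (abs_le_max_abs_abs (hm v hv) (hR v hv)).trans (le_max_left _ _)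
    · exact (hVim v hv).2.trans (le_max_right _ _)
  -- Write `v = g s`. If `g` is a translation, `g.symm s` has real part `2 * s.re - v.re`, which
  -- passes the bound `m`; if it reverses the real axis, the image of a far point does.
  obtain ⟨v, hv, hvR⟩ := hub (2 * M - m)
  obtain ⟨g, hgV, s, hs, rfl⟩ := hSg v hv
  obtain ⟨b, ε, hε, h⟩ := hg g hgV
  have hsM := (hM s hs).2
  rcases hε with rfl | rfl
  · have hw : g.symm s ∈ V := by
      rw [← IsometryEquiv.symm_image_eq_of_image_eq hgV]
      exact Set.mem_image_of_mem _ (hSV hs)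
    have h1 := (h (g.symm s)).2
    rw [g.apply_symm_apply] at h1
    have h2 := hm _ hw
    have h3 := (h s).2
    have h4 : (g.symm s).re = 2 * s.re - (g s).re := by linarith
    rw [h4] at h2
    linarith
  · obtain ⟨w, hw, hwR⟩ := hub (δ * b - m)
    have h1 : g w ∈ V := by
      rw [← hgV]
      exact Set.mem_image_of_mem _ hw
    have h2 := hm _ h1
    rw [(h w).2] at h2
    linarith

/-- The symmetries of a coarsely one-ended orbit set cannot all fix infinity if there is an empty
horoball at infinity, or if the points accumulate only at infinity. -/
theorem false_of_isAffine (hV : IsOneEndedOrbitSet V)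
    (haff : ∀ g : ℍ ≃ᵢ ℍ, g '' V = V → IsAffine g)
    (h : (∃ A : ℝ, ∀ v ∈ V, v.im ≤ A) ∨
      ∀ R : ℝ, {v | v ∈ V ∧ |v.re| ≤ R ∧ v.im ≤ R}.Finite) : False := by
  have hlt : ∀ g : ℍ ≃ᵢ ℍ, g '' V = V → ∀ a b ε : ℝ, 0 < a → (ε = 1 ∨ ε = -1) →
      (∀ z, (g z).im = a * z.im ∧ (g z).re = ε * a * z.re + b) → a < 1 → False := by
    intro g hgV a b ε ha hε hg ha1
    obtain ⟨v, hv⟩ := hV.infinite.nonempty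
    rcases h with ⟨A, hA⟩ | h
    -- Pulling `v` back along the contraction makes heights grow beyond `A`.
    · have hn : ∀ n : ℕ, ∃ w ∈ V, a ^ n * w.im = v.im := by
        intro n
        induction n with
        | zero => exact ⟨v, hv, by simp⟩
        | succ n ih =>
          obtain ⟨w, hw, e⟩ := ih
          rw [← hgV] at hw
          obtain ⟨u, hu, rfl⟩ := hw
          rw [(hg u).1] at e
          exact ⟨u, hu, by rw [← e]; ring⟩
      have hApos : 0 < A := v.im_pos.trans_le (hA v hv)
      obtain ⟨n, hn'⟩ := exists_pow_lt_of_lt_one (div_pos v.im_pos hApos) ha1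
      obtain ⟨w, hw, e⟩ := hn n
      rw [lt_div_iff₀ hApos] at hn'
      have := mul_le_mul_of_nonneg_left (hA w hw) (pow_pos ha n).le
      linarith
    -- Since `a * R + |b| ≤ R`, the strip `|re| ≤ R` is invariant, and the forward orbit of `v` is
    -- an infinite subset of a bounded region.
    · let R := max (max |v.re| v.im) (|b| / (1 - a))
      have hR1 : |v.re| ≤ R := (le_max_left _ _).trans (le_max_left _ _)
      have hR2 : v.im ≤ R := (le_max_right _ _).trans (le_max_left _ _)
      have hR3 : |b| ≤ R * (1 - a) := (div_le_iff₀ (by linarith)).1 (le_max_right _ _)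
      have hn : ∀ n : ℕ, ∃ w ∈ V, |w.re| ≤ R ∧ w.im = a ^ n * v.im := by
        intro n
        induction n with
        | zero => exact ⟨v, hv, hR1, by simp⟩
        | succ n ih =>
          obtain ⟨w, hw, hwR, e⟩ := ih
          refine ⟨g w, ?_, ?_, by rw [(hg w).1, e]; ring⟩
          · rw [← hgV]; exact Set.mem_image_of_mem _ hw
          · rw [(hg w).2]
            have h1 : |ε * a * w.re| = a * |w.re| := by
              rcases hε with rfl | rfl <;> simp [abs_mul, abs_of_pos ha]
            have h2 := abs_add_le (ε * a * w.re) b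
            have h3 := mul_le_mul_of_nonneg_left hwR ha.le
            linarith
      choose w hw hwR hwim using hn
      have hinj : Function.Injective w := by
        intro i j hij
        have h1 : a ^ i * v.im = a ^ j * v.im := by rw [← hwim, ← hwim, hij]
        have h2 := mul_right_cancel₀ v.im_ne_zero h1
        exact (pow_right_strictAnti₀ ha ha1).injective h2
      refine Set.infinite_range_of_injective hinj ((h R).subset ?_)
      rintro _ ⟨n, rfl⟩
      refine ⟨hw n, hwR n, ?_⟩
      rw [hwim]
      have := pow_le_one₀ (n := n) ha.le ha1.le
      have := mul_le_mul_of_nonneg_right this v.im_pos.le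
      linarith
  have hg1 : ∀ g : ℍ ≃ᵢ ℍ, g '' V = V → ∃ b ε : ℝ, (ε = 1 ∨ ε = -1) ∧
      ∀ z, (g z).im = z.im ∧ (g z).re = ε * z.re + b := by
    intro g hgV
    obtain ⟨a, b, ε, ha, hε, hg⟩ := haff g hgV
    rcases lt_trichotomy a 1 with h1 | h1 | h1
    · exact (hlt g hgV a b ε ha hε hg h1).elim
    · subst h1
      exact ⟨b, ε, hε, fun z => by simpa using hg z⟩
    · refine (hlt g.symm (IsometryEquiv.symm_image_eq_of_image_eq hgV) a⁻¹ (-ε * a⁻¹ * b) ε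
        (inv_pos.2 ha) hε (fun z => ?_) (inv_lt_one_of_one_lt₀ h1)).elim
      obtain ⟨e1, e2⟩ := hg (g.symm z)
      rw [g.apply_symm_apply] at e1 e2
      have hε2 : ε * ε = 1 := by rcases hε with rfl | rfl <;> norm_num
      rw [e1, e2]
      constructor
      · field_simp
      · field_simp
        linear_combination (-(a * (g.symm z).re)) * hε2
  obtain ⟨S, hSV, hS, hSg⟩ := hV.orbits
  have hfin : ∀ C : ℝ, {v | v ∈ V ∧ |v.re - 0| ≤ C * v.im}.Finite := by
    intro C
    have hS0 : S.Nonempty := by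
      obtain ⟨v, hv⟩ := hV.infinite.nonempty
      obtain ⟨g, -, s, hs, -⟩ := hSg v hv
      exact ⟨s, hs⟩
    obtain ⟨s, hs, h⟩ := Set.exists_min_image S UpperHalfPlane.im hS hS0
    obtain ⟨s', hs', h'⟩ := Set.exists_max_image S UpperHalfPlane.im hS hS0
    refine (hV.finite_box ((|C| + 1) * s'.im) s.im_pos).subset ?_
    rintro v ⟨hv, hvC⟩
    obtain ⟨g, hgV, x, hx, rfl⟩ := hSg v hv
    obtain ⟨b, ε, hε, hgx⟩ := hg1 g hgV
    rw [sub_zero, (hgx x).1] at hvC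
    have h1 := h x hx
    have h2 := h' x hx
    have h3 : C * x.im ≤ |C| * s'.im :=
      mul_le_mul (le_abs_self C) h2 x.im_pos.le (abs_nonneg C)
    have h4 := s'.im_pos
    refine ⟨hv, by linarith, by rw [(hgx x).1]; exact h1, ?_⟩
    rw [(hgx x).1]
    nlinarith [abs_nonneg C]
  rcases hV.finite_side 0 hfin with h1 | h1
  · exact hV.false_of_im_eq_of_finite_side hg1 1 (Or.inl rfl) (by simpa using h1)
  · exact hV.false_of_im_eq_of_finite_side hg1 (-1) (Or.inr rfl) (by simpa using h1)

/-! ### Limit points of Euclidean-bounded orbit sets. -/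

/-- The real number `x` is a limit point of `T` on the boundary of the half-plane. -/
def IsLimitPt (T : Set ℍ) (x : ℝ) : Prop :=
  ∀ ε > 0, {v | v ∈ T ∧ |v.re - x| < ε ∧ v.im < ε}.Infinite

/-- Otherwise compactness of `[-B, B]` leaves finitely many points of `T` below some height `ε`, and
those above it lie in a compact box. -/
theorem exists_isLimitPt (hV : IsOneEndedOrbitSet V) {B : ℝ}
    (hB : ∀ v ∈ V, |v.re| ≤ B ∧ v.im ≤ B) {T : Set ℍ} (hTV : T ⊆ V) (hT : T.Infinite) :
    ∃ x, IsLimitPt T x := by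
  by_contra hcon
  simp only [IsLimitPt, not_exists, not_forall, Set.not_infinite] at hcon
  have key : ∃ ε > 0, {v | v ∈ T ∧ v.re ∈ Set.Icc (-B) B ∧ v.im < ε}.Finite := by
    refine isCompact_Icc.induction_on (p := fun s => ∃ ε > 0, {v | v ∈ T ∧ v.re ∈ s ∧ v.im < ε}.Finite)
      ⟨1, one_pos, by simp⟩ ?_ ?_ ?_
    · rintro s t hst ⟨ε, hε, h⟩
      exact ⟨ε, hε, h.subset fun v hv => ⟨hv.1, hst hv.2.1, hv.2.2⟩⟩
    · rintro s t ⟨ε, hε, h⟩ ⟨η, hη, h'⟩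
      refine ⟨min ε η, lt_min hε hη, (h.union h').subset ?_⟩
      rintro v ⟨hv, hst | hst, hlt⟩
      · exact Or.inl ⟨hv, hst, hlt.trans_le (min_le_left _ _)⟩
      · exact Or.inr ⟨hv, hst, hlt.trans_le (min_le_right _ _)⟩
    · intro x _
      obtain ⟨ε, hε, h⟩ := hcon x
      refine ⟨Metric.ball x ε, mem_nhdsWithin_of_mem_nhds (Metric.ball_mem_nhds x hε), ε, hε,
        h.subset fun v hv => ⟨hv.1, ?_, hv.2.2⟩⟩
      simpa [Real.dist_eq] using hv.2.1
  obtain ⟨ε, hε, h⟩ := key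
  refine hT ((h.union (hV.finite_box B hε)).subset fun v hv => ?_)
  obtain ⟨h1, h2⟩ := hB v (hTV hv)
  by_cases h3 : v.im < ε
  · exact Or.inl ⟨hv, abs_le.1 h1, h3⟩
  · exact Or.inr ⟨hTV hv, h1, not_lt.1 h3, h2⟩

/-- Small neighbourhoods of `a` and `b` lie on different sides of `t`; this contradicts the
conclusion of `finite_side`. -/
theorem infinite_sides {a b t : ℝ} (ha : IsLimitPt V a) (hb : IsLimitPt V b) (hat : a < t)
    (htb : t < b) : ¬ ({v | v ∈ V ∧ v.re ≤ t}.Finite ∨ {v | v ∈ V ∧ t ≤ v.re}.Finite) := by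
  rintro (h | h)
  · refine ha (t - a) (by linarith) (h.subset fun v hv => ⟨hv.1, ?_⟩)
    have := (abs_lt.1 hv.2.1).2
    linarith
  · refine hb (b - t) (by linarith) (h.subset fun v hv => ⟨hv.1, ?_⟩)
    have := (abs_lt.1 hv.2.1).1
    linarith

/-- If two limit points surround `t`, then `t` is a limit point. -/
theorem isLimitPt_of_mem_Ioo (hV : IsOneEndedOrbitSet V) {B : ℝ}
    (hB : ∀ v ∈ V, |v.re| ≤ B ∧ v.im ≤ B) {a b t : ℝ} (ha : IsLimitPt V a) (hb : IsLimitPt V b)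
    (hat : a < t) (htb : t < b) : IsLimitPt V t := by
  have h1 : ¬ ∀ C : ℝ, {v | v ∈ V ∧ |v.re - t| ≤ C * v.im}.Finite := fun h =>
    infinite_sides ha hb hat htb (hV.finite_side t h)
  push Not at h1
  obtain ⟨C, hC⟩ := h1
  -- Infinitely many points lie in a cone with apex `t`, and the apex is the only boundary point
  -- they can approach.
  obtain ⟨x, hx⟩ := hV.exists_isLimitPt hB (fun v hv => hv.1) hC
  have hxt : x = t := by
    by_contra hne
    have hpos : 0 < |x - t| := abs_pos.2 (sub_ne_zero.2 hne)
    obtain ⟨v, ⟨hv, hvC⟩, hvx, hvi⟩ := (hx (|x - t| / (|C| + 1)) (by positivity)).nonempty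
    have h2 : |x - t| ≤ |v.re - x| + |v.re - t| := by
      rw [abs_sub_comm v.re x]
      exact abs_sub_le x v.re t
    have h3 : C * v.im ≤ |C| * (|x - t| / (|C| + 1)) :=
      mul_le_mul (le_abs_self C) hvi.le v.im_pos.le (abs_nonneg C)
    have h4 : |C| * (|x - t| / (|C| + 1)) + |x - t| / (|C| + 1) = |x - t| := by
      field_simp
    linarith
  subst hxt
  exact fun ε hε => (hx ε hε).mono fun v hv => ⟨hv.1.1, hv.2⟩

/-- Near a limit point there are poles of symmetries. -/
theorem exists_pole_near (hV : IsOneEndedOrbitSet V) {B : ℝ}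
    (hB : ∀ v ∈ V, |v.re| ≤ B ∧ v.im ≤ B) {t : ℝ} (ht : IsLimitPt V t) {η : ℝ} (hη : 0 < η) :
    ∃ k τ : ℝ, 0 < k ∧ |τ - t| < η ∧
      ∀ v ∈ V, k * v.im ≤ B * ((v.re - τ) ^ 2 + v.im ^ 2) := by
  obtain ⟨S, hSV, hS, hSg⟩ := hV.orbits
  obtain ⟨w, hw⟩ := hV.infinite.nonempty
  obtain ⟨c, hc, hcS⟩ : ∃ c : ℝ, 0 < c ∧ ∀ s ∈ S, c ≤ s.im := by
    obtain ⟨s, hs, h⟩ := Set.exists_min_image S UpperHalfPlane.im hS (by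
      obtain ⟨g, -, s, hs, -⟩ := hSg w hw
      exact ⟨s, hs⟩)
    exact ⟨s.im, s.im_pos, h⟩
  have hwi := w.im_pos
  have hBpos : 0 < B := hwi.trans_le (hB w hw).2
  have hD : 0 < c * w.im := mul_pos hc hwi
  -- The bounds serve the last triangle inequality, the exclusion of affine maps together with
  -- absorbing the term `2 * q` in `h3`, and the term `9 * B ^ 2` there.
  obtain ⟨ε, hε, hε1, hε2, hε3⟩ : ∃ ε > 0, ε < η / 2 ∧ 4 * B * ε < c * w.im ∧
      20 * B ^ 3 * ε < c * w.im * (η / 2) ^ 2 / 2 := by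
    have e1 : 0 < c * w.im / (4 * B) := by positivity
    have e2 : 0 < c * w.im * (η / 2) ^ 2 / 2 / (20 * B ^ 3) := by positivity
    obtain ⟨ε, hε, h⟩ := exists_between (lt_min (half_pos hη) (lt_min e1 e2))
    rw [lt_min_iff, lt_min_iff, lt_div_iff₀ (c := 4 * B) (by positivity),
      lt_div_iff₀ (c := 20 * B ^ 3) (by positivity)] at h
    exact ⟨ε, hε, h.1, by linarith, by linarith⟩
  obtain ⟨v, hv, hvt, hvi⟩ := (ht ε hε).nonempty
  have hvpos := v.im_pos
  obtain ⟨g, hgV, s, hs, hgs⟩ := hSg v hv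
  have hgs' : g.symm v = s := by rw [← hgs, g.symm_apply_apply]
  have hmem : ∀ u ∈ V, g.symm u ∈ V := fun u hu => by
    rw [← IsometryEquiv.symm_image_eq_of_image_eq hgV]
    exact Set.mem_image_of_mem _ hu
  have hsc := hcS s hs
  have hgw := (hB _ (hmem w hw)).2
  -- `g.symm` lifts the very low point `v` to height at least `c` while keeping `w` below `B`. An
  -- affine map would lift `w` too far, so there is a pole, and it must be close to `v`.
  rcases isometry_coords g.symm.isometry with ⟨a, b, δ, ha, -, h⟩ | ⟨k, τ, κ, hk, h⟩
  · exfalso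
    have h1 := (h v).1
    rw [hgs'] at h1
    rw [(h w).1] at hgw
    have h2 : c * w.im ≤ B * v.im := by
      calc c * w.im ≤ (a * v.im) * w.im := mul_le_mul_of_nonneg_right (by linarith) hwi.le
        _ = (a * w.im) * v.im := by ring
        _ ≤ B * v.im := mul_le_mul_of_nonneg_right hgw hvpos.le
    have h3 : B * v.im ≤ B * ε := mul_le_mul_of_nonneg_left hvi.le hBpos.le
    nlinarith [mul_pos hBpos hε]
  · have hpole : ∀ u ∈ V, k * u.im ≤ B * ((u.re - τ) ^ 2 + u.im ^ 2) := by
      intro u hu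
      rw [← (h u).1]
      exact mul_le_mul_of_nonneg_right (hB _ (hmem u hu)).2 (by positivity)
    refine ⟨k, τ, hk, ?_, hpole⟩
    have h1 := (h v).1
    rw [hgs'] at h1
    obtain ⟨q, hq⟩ : ∃ q, q = (v.re - τ) ^ 2 + v.im ^ 2 := ⟨_, rfl⟩
    have hqpos : 0 ≤ q := by rw [hq]; positivity
    have hwB := hB w hw
    have hvB := hB v hv
    have h2 : (w.re - τ) ^ 2 + w.im ^ 2 ≤ 2 * q + 9 * B ^ 2 := by
      have e1 : (w.re - v.re) ^ 2 ≤ (2 * B) ^ 2 := by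
        refine sq_le_sq' ?_ ?_ <;> linarith [abs_le.1 hwB.1, abs_le.1 hvB.1]
      have e2 : w.im ^ 2 ≤ B ^ 2 := pow_le_pow_left₀ hwi.le hwB.2 2
      rw [hq]
      nlinarith [sq_nonneg ((w.re - v.re) - (v.re - τ)), sq_nonneg v.im]
    have h3 : c * w.im * q ≤ B * ε * (2 * q + 9 * B ^ 2) := by
      calc c * w.im * q ≤ s.im * q * w.im := by
            have := mul_le_mul_of_nonneg_right hsc (mul_nonneg hqpos hwi.le)
            linarith
        _ = (k * w.im) * v.im := by rw [hq, h1]; ring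
        _ ≤ (B * (2 * q + 9 * B ^ 2)) * v.im :=
            mul_le_mul_of_nonneg_right ((hpole w hw).trans
              (mul_le_mul_of_nonneg_left h2 hBpos.le)) hvpos.le
        _ ≤ (B * (2 * q + 9 * B ^ 2)) * ε := mul_le_mul_of_nonneg_left hvi.le (by positivity)
        _ = B * ε * (2 * q + 9 * B ^ 2) := by ring
    have h4 : q < (η / 2) ^ 2 := by
      by_contra hcon
      push Not at hcon
      have e1 : c * w.im / 2 * (η / 2) ^ 2 ≤ c * w.im / 2 * q :=
        mul_le_mul_of_nonneg_left hcon (by positivity)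
      have e2 : 4 * B * ε * q ≤ c * w.im * q := mul_le_mul_of_nonneg_right hε2.le hqpos
      have e3 : 0 < B ^ 3 * ε := by positivity
      nlinarith
    have h5 : |v.re - τ| < η / 2 := by
      refine abs_lt_of_sq_lt_sq ?_ (by positivity)
      nlinarith [sq_nonneg v.im]
    have h6 : |τ - t| ≤ |v.re - τ| + |v.re - t| := by
      rw [abs_sub_comm v.re τ]
      exact abs_sub_le τ v.re t
    linarith

/-- A coarsely one-ended orbit set is unbounded in the Euclidean metric. -/
theorem false_of_bounded (hV : IsOneEndedOrbitSet V) {B : ℝ}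
    (hB : ∀ v ∈ V, |v.re| ≤ B ∧ v.im ≤ B) : False := by
  -- Their midpoint is a limit point, so a pole separates them; the empty horoballs at the pole and
  -- at infinity leave one side finite.
  have huniq : ∀ a b, IsLimitPt V a → IsLimitPt V b → ¬ a < b := by
    intro a b ha hb hab
    have ht := hV.isLimitPt_of_mem_Ioo hB ha hb (t := (a + b) / 2) (by linarith) (by linarith)
    obtain ⟨k, τ, hk, hτ, h⟩ := hV.exists_pole_near hB ht (η := (b - a) / 2) (by linarith)
    have := abs_lt.1 hτ
    exact infinite_sides ha hb (by linarith) (by linarith)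
      (hV.finite_side_of_horoballs hk (fun v hv => (hB v hv).2) h)
  obtain ⟨a, ha⟩ := hV.exists_isLimitPt hB subset_rfl hV.infinite
  obtain ⟨φ, hφ⟩ := exists_inversion a
  have hV' := hV.image φ
  have hfin : ∀ R : ℝ, {v | v ∈ φ '' V ∧ |v.re| ≤ R ∧ v.im ≤ R}.Finite := by
    intro R
    by_contra hinf
    let T := {v | v ∈ V ∧ |(φ v).re| ≤ R ∧ (φ v).im ≤ R}
    have hT : T.Infinite := by
      intro hT
      refine hinf ((hT.image φ).subset ?_)
      rintro _ ⟨⟨v, hv, rfl⟩, h⟩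
      exact ⟨v, ⟨hv, h⟩, rfl⟩
    obtain ⟨x, hx⟩ := hV.exists_isLimitPt hB (T := T) (fun v hv => hv.1) hT
    have hxV : IsLimitPt V x := fun ε hε => (hx ε hε).mono fun v hv => ⟨hv.1.1, hv.2⟩
    have hxa : x = a := le_antisymm (not_lt.1 (huniq a x ha hxV)) (not_lt.1 (huniq x a hxV ha))
    subst hxa
    -- With this radius `ε`, the product `|φ v|² * |v - x|² = 1` would be at most `(2 * |R| * ε)² <
    -- 1`.
    obtain ⟨v, hv, hvx, hvi⟩ := (hx (1 / (2 * |R| + 1)) (by positivity)).nonempty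
    have h1 := (hφ v).2
    have e1 : (φ v).re ^ 2 ≤ |R| ^ 2 := sq_le_sq.2 (by rw [abs_abs]; exact hv.2.1.trans (le_abs_self R))
    have e2 : (φ v).im ^ 2 ≤ |R| ^ 2 := pow_le_pow_left₀ (φ v).im_pos.le (hv.2.2.trans (le_abs_self R)) 2
    obtain ⟨ε, hε⟩ : ∃ ε, ε = 1 / (2 * |R| + 1) := ⟨_, rfl⟩
    rw [← hε] at hvx hvi
    have e3 : (v.re - x) ^ 2 ≤ ε ^ 2 := sq_le_sq.2 (hvx.le.trans (le_abs_self _))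
    have e4 : v.im ^ 2 ≤ ε ^ 2 := pow_le_pow_left₀ v.im_pos.le hvi.le 2
    have e5 : (1 : ℝ) ≤ (|R| ^ 2 + |R| ^ 2) * (ε ^ 2 + ε ^ 2) := by
      rw [← h1]
      exact mul_le_mul (add_le_add e1 e2) (add_le_add e3 e4) (by positivity) (by positivity)
    have e6 : 2 * |R| * ε < 1 := by
      rw [hε, mul_one_div, div_lt_one (by positivity)]
      linarith
    have e7 : 0 ≤ 2 * |R| * ε := by rw [hε]; positivity
    nlinarith
  refine hV'.false_of_isAffine (fun g hg => ?_) (Or.inr hfin)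
  rcases isometry_coords g.isometry with h | ⟨k, τ, κ, hk, h⟩
  · exact h
  · exfalso
    -- A point at distance at least `k` from `τ` is sent within distance 1 of `κ`. Both bounded
    -- regions contain finitely many points, so the set would be finite.
    obtain ⟨R, hR⟩ : ∃ R, R = |κ| + 1 := ⟨_, rfl⟩
    refine hV'.infinite (((hfin (|τ| + k)).union ((hfin R).preimage g.injective.injOn)).subset
      fun v hv => ?_)
    by_cases hvk : |v.re| ≤ |τ| + k ∧ v.im ≤ |τ| + k
    · exact Or.inl ⟨hv, hvk⟩
    · right
      have hgv : g v ∈ φ '' V := by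
        rw [← hg]; exact Set.mem_image_of_mem _ hv
      have hq : k ^ 2 ≤ (v.re - τ) ^ 2 + v.im ^ 2 := by
        by_contra hcon
        push Not at hcon
        apply hvk
        have e1 : |v.re - τ| < k := abs_lt_of_sq_lt_sq (by nlinarith [sq_nonneg v.im]) hk.le
        have e2 : v.im < k := lt_of_pow_lt_pow_left₀ 2 hk.le (by nlinarith [sq_nonneg (v.re - τ)])
        have e3 := abs_add_le (v.re - τ) τ
        rw [sub_add_cancel] at e3
        exact ⟨by linarith, by linarith [abs_nonneg τ]⟩
      have hp : ((g v).re - κ) ^ 2 + (g v).im ^ 2 ≤ 1 := by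
        by_contra hcon
        push Not at hcon
        have e1 := (h v).2
        have e2 : 0 < k ^ 2 := by positivity
        nlinarith
      have e1 : |(g v).re - κ| ≤ 1 := abs_le_one_iff_mul_self_le_one.2 (by nlinarith [sq_nonneg (g v).im])
      have e2 : (g v).im ≤ 1 := by
        by_contra hcon
        push Not at hcon
        nlinarith [sq_nonneg ((g v).re - κ)]
      have e3 := abs_add_le ((g v).re - κ) κ
      rw [sub_add_cancel] at e3
      exact ⟨hgv, by linarith, by linarith [abs_nonneg κ]⟩

/-! ### Exclusion of empty horoballs. -/

/-- A coarsely one-ended orbit set meets every horoball at infinity. -/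
theorem false_of_im_le (hV : IsOneEndedOrbitSet V) {A : ℝ} (hA : ∀ v ∈ V, v.im ≤ A) : False := by
  refine hV.false_of_isAffine (fun g hg => ?_) (Or.inl ⟨A, hA⟩)
  rcases isometry_coords g.isometry with h | ⟨k, τ, κ, hk, h⟩
  · exact h
  exfalso
  have hpole : ∀ u ∈ V, k * u.im ≤ A * ((u.re - τ) ^ 2 + u.im ^ 2) := by
    intro u hu
    rw [← (h u).1]
    refine mul_le_mul_of_nonneg_right (hA _ ?_) (by positivity)
    rw [← hg]; exact Set.mem_image_of_mem _ hu
  -- Taking `c` one unit into the finite side keeps `V` away from `c`, so inversion at `c` makes it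
  -- bounded.
  obtain ⟨c, hc⟩ : ∃ c : ℝ, {v | v ∈ V ∧ |v.re - c| ≤ 1}.Finite := by
    rcases hV.finite_side_of_horoballs hk hA hpole with h1 | h1
    · refine ⟨τ - 1, h1.subset fun v hv => ⟨hv.1, ?_⟩⟩
      linarith [(abs_le.1 hv.2).2]
    · refine ⟨τ + 1, h1.subset fun v hv => ⟨hv.1, ?_⟩⟩
      linarith [(abs_le.1 hv.2).1]
  obtain ⟨ε, hε, hεV⟩ : ∃ ε > 0, ∀ v ∈ V, ε ≤ (v.re - c) ^ 2 + v.im ^ 2 := by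
    rcases Set.eq_empty_or_nonempty {v | v ∈ V ∧ |v.re - c| ≤ 1} with he | hne
    · refine ⟨1, one_pos, fun v hv => ?_⟩
      have h1 : ¬ |v.re - c| ≤ 1 := fun h1 => Set.eq_empty_iff_forall_notMem.1 he v ⟨hv, h1⟩
      rw [abs_le_one_iff_mul_self_le_one] at h1
      nlinarith [sq_nonneg v.im]
    · obtain ⟨w, hw, hmin⟩ := Set.exists_min_image _ UpperHalfPlane.im hc hne
      refine ⟨min 1 (w.im ^ 2), lt_min one_pos (pow_pos w.im_pos 2), fun v hv => ?_⟩
      by_cases h1 : |v.re - c| ≤ 1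
      · have := pow_le_pow_left₀ w.im_pos.le (hmin v ⟨hv, h1⟩) 2
        exact (min_le_right _ _).trans (by nlinarith [sq_nonneg (v.re - c)])
      · rw [abs_le_one_iff_mul_self_le_one] at h1
        exact (min_le_left _ _).trans (by nlinarith [sq_nonneg v.im])
  obtain ⟨φ, hφ⟩ := exists_inversion c
  refine (hV.image φ).false_of_bounded (B := √(1 / ε)) ?_
  rintro _ ⟨v, hv, rfl⟩
  have h1 : (φ v).re ^ 2 + (φ v).im ^ 2 ≤ 1 / ε := by
    rw [le_div_iff₀ hε, ← (hφ v).2]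
    exact mul_le_mul_of_nonneg_left (hεV v hv) (by positivity)
  exact ⟨Real.abs_le_sqrt (by nlinarith [sq_nonneg (φ v).im]),
    Real.le_sqrt_of_sq_le (by nlinarith [sq_nonneg (φ v).re])⟩

/-- A coarsely one-ended orbit set meets every horoball. -/
theorem false_of_horoball (hV : IsOneEndedOrbitSet V) {α β γ δ : ℝ} (hα : 0 ≤ α)
    (hsum : α + γ = 1) (hdisc : β ^ 2 = 4 * (α * γ)) (hδ : 0 < δ)
    (h : ∀ v ∈ V, δ * v.im ≤ α * (v.re ^ 2 + v.im ^ 2) + β * v.re + γ) : False := by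
  -- The discriminant condition makes the right side of `h` vanish at a single boundary point, the
  -- horoball's centre: infinity if `α = 0`, else `-β / (2 * α)`.
  rcases hα.eq_or_lt with rfl | hα
  · have hβ : β = 0 := by simpa using hdisc
    refine hV.false_of_im_le (A := 1 / δ) fun v hv => ?_
    have := h v hv
    rw [le_div_iff₀ hδ]
    simp only [hβ] at this
    linarith
  · obtain ⟨φ, hφ⟩ := exists_inversion (-β / (2 * α))
    refine (hV.image φ).false_of_im_le (A := α / δ) ?_
    rintro _ ⟨v, hv, rfl⟩
    have h1 := h v hv
    have hvi := v.im_pos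
    obtain ⟨q, hq⟩ : ∃ q, q = (v.re - -β / (2 * α)) ^ 2 + v.im ^ 2 := ⟨_, rfl⟩
    have hqpos : 0 < q := by rw [hq]; positivity
    have h2 : α * (v.re ^ 2 + v.im ^ 2) + β * v.re + γ = α * q := by
      have hγ : γ = β ^ 2 / (4 * α) := by rw [hdisc]; field_simp
      rw [hq, hγ]
      field_simp
      ring
    rw [h2] at h1
    have h3 := (hφ v).1
    rw [← hq] at h3
    rw [le_div_iff₀ hδ]
    refine le_of_mul_le_mul_right ?_ hqpos
    calc (φ v).im * δ * q = δ * ((φ v).im * q) := by ring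
      _ = δ * v.im := by rw [h3]
      _ ≤ α * q := h1

/-! ### Coarse density: limits of empty discs. -/

/-- A large empty disc touches, after a symmetry, one of finitely many points. -/
theorem exists_empty_disc (hV : IsOneEndedOrbitSet V) {S : Set ℍ}
    (hS : ∀ v ∈ V, ∃ g : ℍ ≃ᵢ ℍ, g '' V = V ∧ ∃ s ∈ S, g s = v) {p : ℍ} {R : ℝ}
    (hp : ∀ v ∈ V, R < dist p v) :
    ∃ q : ℍ, ∃ s ∈ S, R < dist q s ∧ ∀ v ∈ V, dist q s ≤ dist q v := by
  obtain ⟨w, hw⟩ := hV.infinite.nonempty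
  obtain ⟨v, ⟨hvb, hv⟩, hmin⟩ := Set.exists_min_image _ (fun v => dist p v)
    (hV.finite_inter _ (isCompact_closedBall p (dist p w)))
    ⟨w, by simp [dist_comm], hw⟩
  obtain ⟨g, hg, s, hs, rfl⟩ := hS v hv
  refine ⟨g.symm p, s, hs, ?_, fun u hu => ?_⟩
  · rw [← g.dist_eq, g.apply_symm_apply]
    exact hp _ hv
  · rw [← g.dist_eq, g.apply_symm_apply, ← g.dist_eq (g.symm p), g.apply_symm_apply]
    have hgu : g u ∈ V := by rw [← hg]; exact Set.mem_image_of_mem _ hu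
    by_cases h : dist p (g u) ≤ dist p w
    · exact hmin _ ⟨by simpa [dist_comm] using h, hgu⟩
    · exact (hmin w ⟨by simp [dist_comm], hw⟩).trans (not_le.1 h).le

/-- A coarsely one-ended orbit set is coarsely dense in the hyperbolic plane. -/
theorem exists_forall_dist_le (hV : IsOneEndedOrbitSet V) :
    ∃ R : ℝ, ∀ p : ℍ, ∃ v ∈ V, dist p v ≤ R := by
  by_contra hcon
  push Not at hcon
  obtain ⟨S, -, hSfin, hS⟩ := hV.orbits
  have hn : ∀ n : ℕ, ∃ q : ℍ, ∃ s ∈ S, (n : ℝ) < dist q s ∧ ∀ v ∈ V, dist q s ≤ dist q v := by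
    intro n
    obtain ⟨p, hp⟩ := hcon n
    exact hV.exists_empty_disc hS hp
  choose p s hsS hlt hle using hn
  -- Dividing the circle equation about `p n` by `N n` normalises it to `α + γ = 1`, so the
  -- coefficients stay in a compact set as `p n` escapes.
  let N : ℕ → ℝ := fun n => 1 + (p n).re ^ 2 + (p n).im ^ 2
  have hN : ∀ n, 0 < N n := fun n => by positivity
  let α : ℕ → ℝ := fun n => 1 / N n
  let β : ℕ → ℝ := fun n => -2 * (p n).re / N n
  let γ : ℕ → ℝ := fun n => ((p n).re ^ 2 + (p n).im ^ 2) / N n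
  let ρ : ℕ → ℝ := fun n => (p n).im / N n
  have hα : ∀ n, 0 ≤ α n := fun n => by positivity
  have hγ : ∀ n, 0 ≤ γ n := fun n => by positivity
  have hρ : ∀ n, 0 < ρ n := fun n => div_pos (p n).im_pos (hN n)
  have hsum : ∀ n, α n + γ n = 1 := fun n => by
    have := (hN n).ne'
    simp only [α, γ]
    field_simp
    simp only [N]
    ring
  have hdisc : ∀ n, β n ^ 2 = 4 * (α n * γ n) - 4 * ρ n ^ 2 := fun n => by
    have := (hN n).ne'
    simp only [α, β, γ, ρ]
    field_simp
    ring
  have hcosh : ∀ n, ∀ z : ℍ, α n * (z.re ^ 2 + z.im ^ 2) + β n * z.re + γ n =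
      2 * ρ n * Real.cosh (dist (p n) z) * z.im := by
    intro n z
    have h1 := (hN n).ne'
    have h2 := z.im_ne_zero
    have h3 := (p n).im_ne_zero
    rw [cosh_dist']
    simp only [α, β, γ, ρ]
    field_simp
    ring
  have hmem : ∀ n, (α n, β n, γ n, s n) ∈
      Set.Icc (0 : ℝ) 1 ×ˢ Set.Icc (-1 : ℝ) 1 ×ˢ Set.Icc (0 : ℝ) 1 ×ˢ S := by
    intro n
    have h1 := hsum n
    have h2 := hα n
    have h3 := hγ n
    have h4 : β n ^ 2 ≤ 1 := by
      nlinarith [hdisc n, sq_nonneg (α n - γ n), sq_nonneg (ρ n)]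
    exact ⟨⟨h2, by linarith⟩, abs_le.1 (sq_le_one_iff_abs_le_one _ |>.1 h4), ⟨h3, by linarith⟩, hsS n⟩
  obtain ⟨⟨a, b, c, u⟩, hlim, ψ, hψ, htend⟩ := (isCompact_Icc.prod (isCompact_Icc.prod
    (isCompact_Icc.prod hSfin.isCompact))).tendsto_subseq hmem
  have ta : Filter.Tendsto (fun n => α (ψ n)) Filter.atTop (nhds a) :=
    (continuous_fst.tendsto _).comp htend
  have tb : Filter.Tendsto (fun n => β (ψ n)) Filter.atTop (nhds b) :=
    ((continuous_fst.comp continuous_snd).tendsto _).comp htend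
  have tc : Filter.Tendsto (fun n => γ (ψ n)) Filter.atTop (nhds c) :=
    ((continuous_fst.comp (continuous_snd.comp continuous_snd)).tendsto _).comp htend
  have tu : Filter.Tendsto (fun n => s (ψ n)) Filter.atTop (nhds u) :=
    ((continuous_snd.comp (continuous_snd.comp continuous_snd)).tendsto _).comp htend
  have tre : Filter.Tendsto (fun n => (s (ψ n)).re) Filter.atTop (nhds u.re) :=
    (continuous_re.tendsto _).comp tu
  have tim : Filter.Tendsto (fun n => (s (ψ n)).im) Filter.atTop (nhds u.im) :=
    (continuous_im.tendsto _).comp tu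
  let Q : ℕ → ℝ := fun n => α n * ((s n).re ^ 2 + (s n).im ^ 2) + β n * (s n).re + γ n
  have tQ : Filter.Tendsto (fun n => Q (ψ n)) Filter.atTop
      (nhds (a * (u.re ^ 2 + u.im ^ 2) + b * u.re + c)) :=
    ((ta.mul ((tre.pow 2).add (tim.pow 2))).add (tb.mul tre)).add tc
  -- The product `2 * ρ * cosh (dist p s) = Q / s.im` converges while the radius tends to infinity.
  -- Thus the discriminant vanishes in the limit: the discs become a horoball.
  have tρ : Filter.Tendsto (fun n => ρ (ψ n)) Filter.atTop (nhds 0) := by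
    have h1 : Filter.Tendsto (fun n => Q (ψ n) / (s (ψ n)).im * (1 / ((n : ℝ) + 1)))
        Filter.atTop (nhds 0) := by
      have := (tQ.div tim u.im_ne_zero).mul
        (tendsto_one_div_add_atTop_nhds_zero_nat (𝕜 := ℝ))
      simpa using this
    refine squeeze_zero (fun n => (hρ _).le) (fun n => ?_) h1
    have hi := (s (ψ n)).im_pos
    have h2 : Q (ψ n) / (s (ψ n)).im = ρ (ψ n) * (2 * Real.cosh (dist (p (ψ n)) (s (ψ n)))) := by
      simp only [Q]
      rw [hcosh]
      field_simp
    rw [h2, mul_one_div, le_div_iff₀ (by positivity)]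
    refine mul_le_mul_of_nonneg_left ?_ (hρ _).le
    have h3 : (n : ℝ) ≤ ψ n := by exact_mod_cast hψ.id_le n
    have h4 := hlt (ψ n)
    have h5 := Real.add_one_le_exp (dist (p (ψ n)) (s (ψ n)))
    have h6 := Real.exp_pos (-dist (p (ψ n)) (s (ψ n)))
    rw [Real.cosh_eq]
    linarith
  have lsum : a + c = 1 := tendsto_nhds_unique (ta.add tc) (by simp only [hsum]; exact tendsto_const_nhds)
  have ldisc : b ^ 2 = 4 * (a * c) := by
    have := tendsto_nhds_unique (tb.pow 2) ((((ta.mul tc).const_mul 4).sub ((tρ.pow 2).const_mul 4)).congr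
      fun n => (hdisc _).symm)
    simpa using this
  have la : 0 ≤ a := ge_of_tendsto' ta fun n => hα _
  have hupos := u.im_pos
  -- The limit horoball touches `u`, and so does not degenerate.
  have hpos : 0 < a * (u.re ^ 2 + u.im ^ 2) + b * u.re + c := by
    rcases la.eq_or_lt with h0 | h0
    · have hb : b = 0 := by simpa [← h0] using ldisc
      rw [← h0, hb]
      linarith
    · have hc : c = b ^ 2 / (4 * a) := by rw [ldisc]; field_simp
      have : a * (u.re ^ 2 + u.im ^ 2) + b * u.re + c =
          a * ((u.re + b / (2 * a)) ^ 2 + u.im ^ 2) := by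
        rw [hc]; field_simp; ring
      rw [this]
      positivity
  refine hV.false_of_horoball la lsum ldisc (div_pos hpos hupos) fun v hv => ?_
  refine le_of_tendsto_of_tendsto' ((tQ.div tim u.im_ne_zero).mul_const v.im)
    (((ta.mul_const (v.re ^ 2 + v.im ^ 2)).add (tb.mul_const v.re)).add tc) fun n => ?_
  rw [hcosh]
  refine mul_le_mul_of_nonneg_right ?_ v.im_pos.le
  rw [Pi.div_apply, div_le_iff₀ (s (ψ n)).im_pos]
  simp only [Q]
  rw [hcosh]
  refine mul_le_mul_of_nonneg_right ?_ (s (ψ n)).im_pos.le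
  refine mul_le_mul_of_nonneg_left ?_ (by linarith [hρ (ψ n)])
  exact Real.cosh_le_cosh.2 (by
    rw [abs_of_nonneg dist_nonneg, abs_of_nonneg dist_nonneg]; exact hle (ψ n) v hv)

end IsOneEndedOrbitSet

/-! ### From maps to orbit sets. -/

/-- The vertices of a quasi-transitive map have finitely many orbit representatives. -/
theorem SurfaceMap.IsQuasiTransitive.exists_finite_reps {X : Type*} [MetricSpace X]
    {M : SurfaceMap X} {G : Subgroup (X ≃ᵢ X)} (hG : M.IsQuasiTransitive G) :
    ∃ S ⊆ M.verts, S.Finite ∧ ∀ v ∈ M.verts, ∃ g ∈ G, ∃ s ∈ S, g s = v := by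
  have h := hG.2
  choose f hf hfO using fun O : {O : Set X | ∃ v ∈ M.verts, O = {x | ∃ g ∈ G, g v = x}} => O.2
  have : Finite {O : Set X | ∃ v ∈ M.verts, O = {x | ∃ g ∈ G, g v = x}} := h
  refine ⟨Set.range f, ?_, Set.finite_range f, fun v hv => ?_⟩
  · rintro _ ⟨O, rfl⟩
    exact hf O
  · have hmem : v ∈ {x | ∃ g ∈ G, g v = x} := ⟨1, G.one_mem, rfl⟩
    have e := hfO ⟨{x | ∃ g ∈ G, g v = x}, v, hv, rfl⟩
    simp only at e
    rw [e] at hmem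
    obtain ⟨g, hg, h⟩ := hmem
    exact ⟨g, hg, _, ⟨_, rfl⟩, h⟩

/-- The edges of a locally finite quasi-transitive map have bounded length. -/
theorem SurfaceMap.IsQuasiTransitive.exists_dist_le {X : Type*} [MetricSpace X]
    {M : SurfaceMap X} {G : Subgroup (X ≃ᵢ X)} (hG : M.IsQuasiTransitive G)
    (hlf : M.IsLocallyFinite) :
    ∃ L : ℝ, ∀ u v : M.verts, M.graph.Adj u v → dist (u : X) v ≤ L := by
  obtain ⟨S, hSV, hS, hSg⟩ := hG.exists_finite_reps
  let S' : Set M.verts := Subtype.val ⁻¹' S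
  have hS' : S'.Finite := hS.preimage Subtype.val_injective.injOn
  have hfin : (⋃ s ∈ S', (fun v : M.verts => dist (s : X) v) '' M.graph.neighborSet s).Finite :=
    hS'.biUnion fun s _ => (hlf s).image _
  obtain ⟨L, hL⟩ := hfin.bddAbove
  refine ⟨L, fun u v huv => ?_⟩
  obtain ⟨g, hg, s, hs, hgs⟩ := hSg u u.2
  obtain ⟨φ, hφ⟩ := (hG.1 g hg).2
  let s' : M.verts := ⟨s, hSV hs⟩
  have h1 : φ s' = u := Subtype.ext ((hφ s').trans hgs)
  have h2 : φ (φ.symm v) = v := φ.apply_symm_apply v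
  have hadj : M.graph.Adj s' (φ.symm v) := by
    rw [← φ.map_adj_iff, h1, h2]
    exact huv
  have h3 : (v : X) = g (φ.symm v : M.verts) := by
    conv_lhs => rw [← h2]
    exact hφ _
  have h4 : dist (u : X) v = dist (s' : X) (φ.symm v : M.verts) := by
    rw [h3, ← hgs]
    exact g.dist_eq _ _
  rw [h4]
  exact hL (Set.mem_biUnion (x := s') hs ⟨_, hadj, rfl⟩)

/-- With `L` bounding the edge lengths, the graph boundary of a vertex set lies in its metric
`L`-boundary, so the graph's separation property transfers. -/
theorem SurfaceMap.isOneEndedOrbitSet_verts (M : SurfaceMap ℍ)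
    (hconn : M.graph.Connected) (hlf : M.IsLocallyFinite) (hend : M.IsOneEnded)
    (hverts : M.HasLocallyFiniteVerts) {G : Subgroup (ℍ ≃ᵢ ℍ)} (hG : M.IsQuasiTransitive G) :
    IsOneEndedOrbitSet M.verts where
  infinite := by
    by_contra hfin
    have : Finite M.verts := Set.not_infinite.1 hfin
    obtain ⟨hu⟩ := hend
    exact IsEmpty.false hu.default
  finite_inter := hverts
  orbits := by
    obtain ⟨S, hSV, hS, h⟩ := hG.exists_finite_reps
    refine ⟨S, hSV, hS, fun v hv => ?_⟩
    obtain ⟨g, hg, hs⟩ := h v hv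
    exact ⟨g, (hG.1 g hg).1, hs⟩
  separation := by
    obtain ⟨L, hL⟩ := hG.exists_dist_le hlf
    refine ⟨L, fun A hA hfin => ?_⟩
    rcases M.graph.finite_or_finite_compl_of_unique_end hconn.preconnected hlf hend
      (Subtype.val ⁻¹' A) ((hfin.preimage Subtype.val_injective.injOn).subset
        fun u hu => ⟨hu.1, hu.2.choose, ⟨hu.2.choose.2, hu.2.choose_spec.1⟩,
          hL _ _ hu.2.choose_spec.2⟩) with h | h
    · left
      refine (h.image Subtype.val).subset fun x hx => ⟨⟨x, hA hx⟩, hx, rfl⟩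
    · right
      refine (h.image Subtype.val).subset fun x hx => ⟨⟨x, hx.1⟩, hx.2, rfl⟩

/-! ### Fundamental domains and area. -/

theorem IsFundDomain.disjoint_image {X : Type*} [MetricSpace X] {G : Subgroup (X ≃ᵢ X)} {F : Set X}
    (hF : IsFundDomain G F) {g h : G} (hgh : g ≠ h) :
    Disjoint ((g : X ≃ᵢ X) '' F) ((h : X ≃ᵢ X) '' F) := by
  refine Set.disjoint_left.2 ?_
  rintro _ ⟨x, hx, rfl⟩ ⟨y, hy, e⟩
  have hmem : (g : X ≃ᵢ X)⁻¹ * h ∈ G := G.mul_mem (G.inv_mem g.2) h.2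
  have hne : (g : X ≃ᵢ X)⁻¹ * h ≠ 1 := fun e' => hgh (Subtype.ext (inv_mul_eq_one.1 e'))
  refine Set.eq_empty_iff_forall_notMem.1 (hF.disjoint _ hmem hne) x ⟨hx, y, hy, ?_⟩
  rw [IsometryEquiv.mul_apply, e]
  exact (g : X ≃ᵢ X).symm_apply_apply x

/-- A group of isometries with a fundamental domain is countable. -/
theorem IsFundDomain.countable {X : Type*} [MetricSpace X] [TopologicalSpace.SeparableSpace X]
    {G : Subgroup (X ≃ᵢ X)} {F : Set X} (hF : IsFundDomain G F) : Countable G := by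
  have h : (Set.univ : Set G).PairwiseDisjoint fun g => (g : X ≃ᵢ X) '' F :=
    fun _ _ _ _ hgh => hF.disjoint_image hgh
  have hc := h.countable_of_isOpen (fun g _ => (g : X ≃ᵢ X).toHomeomorph.isOpenMap _ hF.isOpen)
    (fun g _ => hF.isConnected.nonempty.image _)
  exact Set.countable_univ_iff.1 hc

theorem UpperHalfPlane.volume_image_isometryEquiv (g : ℍ ≃ᵢ ℍ) (s : Set ℍ) :
    MeasureTheory.volume (g '' s) = MeasureTheory.volume s := by
  obtain ⟨A, hA⟩ := exists_smul_eq_of_isometry g.isometry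
  have : g '' s = (fun z => A • z) '' s := Set.image_congr fun z _ => hA z
  rw [this, Set.image_smul, MeasureTheory.measure_smul]

/-- A fundamental domain of a group acting cocompactly on the hyperbolic plane has finite area. -/
theorem IsFundDomain.volume_lt_top {G : Subgroup (ℍ ≃ᵢ ℍ)} {F : Set ℍ} (hF : IsFundDomain G F)
    {K : Set ℍ} (hK : IsCompact K) (hcov : ∀ z, ∃ g ∈ G, g z ∈ K) :
    MeasureTheory.volume F < ⊤ := by
  have := hF.countable
  have hdisj : Pairwise (Function.onFun Disjoint fun g : G => (g : ℍ ≃ᵢ ℍ) '' F ∩ K) :=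
    fun _ _ hgh => (hF.disjoint_image hgh).mono Set.inter_subset_left Set.inter_subset_left
  have hmeas : ∀ g : G, MeasurableSet ((g : ℍ ≃ᵢ ℍ) '' F ∩ K) := fun g =>
    ((g : ℍ ≃ᵢ ℍ).toHomeomorph.isOpenMap _ hF.isOpen).measurableSet.inter hK.measurableSet
  -- The pieces of `F` may overlap, but their translates in `K` are disjoint, so their areas sum to
  -- at most that of `K`.
  have hsub : F ⊆ ⋃ g : G, (g : ℍ ≃ᵢ ℍ).symm '' ((g : ℍ ≃ᵢ ℍ) '' F ∩ K) := by
    intro z hz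
    obtain ⟨g, hg, hgz⟩ := hcov z
    exact Set.mem_iUnion.2 ⟨⟨g, hg⟩, g z, ⟨⟨z, hz, rfl⟩, hgz⟩, g.symm_apply_apply z⟩
  calc MeasureTheory.volume F
      ≤ ∑' g : G, MeasureTheory.volume ((g : ℍ ≃ᵢ ℍ).symm '' ((g : ℍ ≃ᵢ ℍ) '' F ∩ K)) :=
        (MeasureTheory.measure_mono hsub).trans (MeasureTheory.measure_iUnion_le _)
    _ = ∑' g : G, MeasureTheory.volume ((g : ℍ ≃ᵢ ℍ) '' F ∩ K) := by
        simp only [volume_image_isometryEquiv]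
    _ = MeasureTheory.volume (⋃ g : G, (g : ℍ ≃ᵢ ℍ) '' F ∩ K) :=
        (MeasureTheory.measure_iUnion hdisj hmeas).symm
    _ ≤ MeasureTheory.volume K :=
        MeasureTheory.measure_mono (Set.iUnion_subset fun g => Set.inter_subset_right)
    _ < ⊤ := hK.measure_lt_top

/-- The hyperbolic plane is the upper half-plane with its hyperbolic metric; `volume` on it is the
hyperbolic area `dx dy / y ^ 2`. -/
theorem mainTheorem8 (M : SurfaceMap UpperHalfPlane)
    (hconn : M.graph.Connected) (hlf : M.IsLocallyFinite) (hend : M.IsOneEnded)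
    (hverts : M.HasLocallyFiniteVerts)
    (G : Subgroup (UpperHalfPlane ≃ᵢ UpperHalfPlane)) (hG : M.IsQuasiTransitive G)
    (F : Set UpperHalfPlane) (hF : IsFundDomain G F) :
    MeasureTheory.volume F < ⊤ := by
  obtain ⟨R, hR⟩ :=
    (M.isOneEndedOrbitSet_verts hconn hlf hend hverts hG).exists_forall_dist_le
  obtain ⟨S, -, hS, hSg⟩ := hG.exists_finite_reps
  refine hF.volume_lt_top (K := ⋃ s ∈ S, Metric.closedBall s R)
    (hS.isCompact_biUnion fun s _ => isCompact_closedBall s R) fun z => ?_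
  obtain ⟨v, hv, hzv⟩ := hR z
  obtain ⟨g, hg, s, hs, rfl⟩ := hSg v hv
  refine ⟨g⁻¹, G.inv_mem hg, Set.mem_biUnion hs ?_⟩
  rw [Metric.mem_closedBall, ← g.dist_eq]
  have : g (g⁻¹ z) = z := g.apply_symm_apply z
  rwa [this]
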